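/- Let $(R,\mathfrak m)$ be a one-dimensional Cohen–Macaulay (Noetherian) local ring, let $s\ge 1$, and let $I_1,\dots,I_s$ be $\mathfrak m$-primary ideals of $R$. For $\underline n\in\mathbb Z^s$ write $\underline I^{\underline n}=I_1^{n_1}\cdots I_s^{n_s}$, where $I_i^{k}=R$ for $k\le 0$; write $\underline n^+$ for the vector with entries $\max(n_i,0)$, put $e=(1,\dots,1)\in\mathbb Z^s$, and order $\mathbb Z^s$ componentwise. Let $\mathcal F=\{\mathcal F(\underline n)\}_{\underline n\in\mathbb Z^s}$ be an $\underline I$-admissible filtration of ideals of $R$. That is, for all $\underline m,\underline n\in\mathbb Z^s$: $\underline I^{\underline n}\subseteq\mathcal F(\underline n)$; $\mathcal F(\underline n)\mathcal F(\underline m)\subseteq\mathcal F(\underline n+\underline m)$; $\mathcal F(\underline m)\subseteq\mathcal F(\underline n)$ whenever $\underline m\ge\underline n$; $\mathcal F(\underline n)=\mathcal F(\underline n^+)$; and the extended Rees ring $\bigoplus_{\underline n\in\mathbb Z^s}\mathcal F(\underline n)\,t_1^{n_1}\cdots t_s^{n_s}$ is a finite module over $\bigoplus_{\underline n\in\mathbb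 Z^s}\underline I^{\underline n}\,t_1^{n_1}\cdots t_s^{n_s}$. A complete reduction of $\mathcal F$ is a family $\mathcal A=(a_1,\dots,a_s)$ with $a_i\in I_i$ for all $i$ such that the ideal $J=(a_1\cdots a_s)$ satisfies $J\mathcal F(\underline n)=\mathcal F(\underline n+e)$ for all $\underline n$ with all coordinates sufficiently large. A vector $\underline r\in\mathbb N^s$ is a reduction vector of $\mathcal F$ with respect to $\mathcal A$ if $J\mathcal F(\underline n)=\mathcal F(\underline n+e)$ for all $\underline n\ge\underline r$; let $\mathcal R_{\mathcal A}(\mathcal F)$ be the set of these vectors. The complete reduction number $r_{\mathcal A}(\mathcal F)$ is the least $k\in\mathbb N$ such that $J\mathcal F(\underline n)=\mathcal F(\underline n+e)$ for all $\underline n\ge ke$. Then $r_{\mathcal A}(\mathcal F)$ is the same for all complete reductions $\mathcal A$ of $\mathcal F$, and for every complete reduction $\mathcal A$ of $\mathcal F$ $$r_{\mathcal A}(\mathcal F)=\min\bigl\{\max\{t_1,\dots,t_s\} : (t_1,\dots,t_s)\in\mathcal R_{\mathcal A}(\mathcal F)\bigr\}.$$ -/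

import Mathlib

namespace MultiFil

universe u

variable {R : Type u} [CommRing R] {s : ℕ}

/-- The ideal `I^n = I_1^{n_1} ⋯ I_s^{n_s}` for `n ∈ ℤ^s`, with the convention that `I_i^k = R`
for `k ≤ 0`. -/
def idealPow (I : Fin s → Ideal R) (n : Fin s → ℤ) : Ideal R :=
  ∏ i, I i ^ (n i).toNat

/-- A `ℤ^s`-graded `I`-filtration `F` of ideals of `R`. -/
structure IsFiltration (I : Fin s → Ideal R) (F : (Fin s → ℤ) → Ideal R) : Prop where
  pow_le : ∀ n, idealPow I n ≤ F n
  mul_le : ∀ m n, F n * F m ≤ F (n + m)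
  anti : ∀ m n, n ≤ m → F m ≤ F n

theorem idealPow_mul_le (I : Fin s → Ideal R) (m n : Fin s → ℤ) :
    idealPow I m * idealPow I n ≤ idealPow I (m + n) := by
  unfold idealPow
  rw [← Finset.prod_mul_distrib]
  refine Finset.prod_le_prod' fun i _ => ?_
  rw [← pow_add]
  refine Ideal.pow_le_pow_right ?_
  simp only [Pi.add_apply]
  omega

theorem one_mem_idealPow_zero (I : Fin s → Ideal R) : (1 : R) ∈ idealPow I 0 := by
  simp only [idealPow, Pi.zero_apply, Int.toNat_zero, pow_zero, Finset.prod_const_one]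
  exact Submodule.mem_one.2 ⟨1, map_one _⟩

/-- In the Laurent polynomial ring `R[t_1^{±1}, …, t_s^{±1}]`, products of elements with
coefficients in `A n` and `B n` have coefficients in `C n`, as soon as `A m * B n ≤ C (m + n)`. -/
theorem coeff_mul_mem {A B C : (Fin s → ℤ) → Ideal R}
    (h : ∀ m n, A m * B n ≤ C (m + n)) (f g : AddMonoidAlgebra R (Fin s → ℤ))
    (hf : ∀ n, f.coeff n ∈ A n) (hg : ∀ n, g.coeff n ∈ B n) (n : Fin s → ℤ) :
    (f * g).coeff n ∈ C n := by
  classical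
  rw [AddMonoidAlgebra.coeff_mul]
  simp only [Finsupp.sum]
  refine Ideal.sum_mem _ fun a _ => Ideal.sum_mem _ fun b _ => ?_
  split_ifs with hab
  · rw [← hab]
    exact h a b (Ideal.mul_mem_mul (hf a) (hg b))
  · exact Ideal.zero_mem _

/-- The extended Rees ring `R'(I) = ⨁_{n ∈ ℤ^s} I^n t^n`, inside the Laurent polynomial ring
`R[t_1^{±1}, …, t_s^{±1}] = R[ℤ^s]`. -/
def extRees (I : Fin s → Ideal R) : Subalgebra R (AddMonoidAlgebra R (Fin s → ℤ)) where
  carrier := {f | ∀ n, f.coeff n ∈ idealPow I n}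
  mul_mem' {f g} hf hg := coeff_mul_mem (idealPow_mul_le I) f g hf hg
  add_mem' {f g} hf hg := fun n => by
    rw [AddMonoidAlgebra.coeff_add]
    exact Ideal.add_mem _ (hf n) (hg n)
  algebraMap_mem' r := fun n => by
    classical
    rw [AddMonoidAlgebra.coe_algebraMap]
    simp only [Function.comp_apply, AddMonoidAlgebra.coeff_single, Finsupp.single_apply]
    split_ifs with h
    · rw [← h]
      exact (Ideal.eq_top_iff_one _).2 (one_mem_idealPow_zero I) ▸ Submodule.mem_top
    · exact Ideal.zero_mem _

/-- The extended Rees ring `R'(F) = ⨁_{n ∈ ℤ^s} F(n) t^n` of an `I`-filtration `F`, as a module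
over `R'(I)`. -/
def extReesModule {I : Fin s → Ideal R} {F : (Fin s → ℤ) → Ideal R} (hF : IsFiltration I F) :
    Submodule (extRees I) (AddMonoidAlgebra R (Fin s → ℤ)) where
  carrier := {f | ∀ n, f.coeff n ∈ F n}
  zero_mem' := fun n => by simp
  add_mem' {f g} hf hg := fun n => by
    rw [AddMonoidAlgebra.coeff_add]
    exact Ideal.add_mem _ (hf n) (hg n)
  smul_mem' a f hf := coeff_mul_mem
    (fun m n => (Ideal.mul_mono_left (hF.pow_le m)).trans (hF.mul_le n m)) a.1 f a.2 hf

/-- An `I`-admissible filtration: `F(n) = F(n⁺)` for all `n ∈ ℤ^s`, and `R'(F)` is a finite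
`R'(I)`-module. -/
structure IsAdmissible (I : Fin s → Ideal R) (F : (Fin s → ℤ) → Ideal R) : Prop
    extends IsFiltration I F where
  eq_posPart : ∀ n, F n = F (fun i => max (n i) 0)
  finite : Module.Finite (extRees I) (extReesModule toIsFiltration)

/-- The ideal `J = (y_1, …, y_d)`, where `y_j = x_{1j} ⋯ x_{sj}`. -/
def productIdeal {d : ℕ} (x : Fin s → Fin d → R) : Ideal R :=
  Ideal.span (Set.range fun j => ∏ i, x i j)

/-- The array `x_{ij} ∈ I_i` (`1 ≤ i ≤ s`, `1 ≤ j ≤ d`) is a complete reduction of `F`: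
`J F(n) = F(n + e)` for all large `n`, where `e = (1, …, 1)`. Here `d` is meant to be the
dimension of `R`. -/
def IsCompleteReduction {d : ℕ} (I : Fin s → Ideal R) (F : (Fin s → ℤ) → Ideal R)
    (x : Fin s → Fin d → R) : Prop :=
  (∀ i j, x i j ∈ I i) ∧
    ∃ N : Fin s → ℤ, ∀ n, N ≤ n → productIdeal x * F n = F (n + 1)

/-- The set of reduction vectors of `F` with respect to the array `x`: the `r ∈ ℕ^s` such that
`J F(n) = F(n + e)` for all `n ≥ r`. -/
def reductionVectors {d : ℕ} (F : (Fin s → ℤ) → Ideal R) (x : Fin s → Fin d → R) :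
    Set (Fin s → ℕ) :=
  {r | ∀ n : Fin s → ℤ, (∀ i, (r i : ℤ) ≤ n i) → productIdeal x * F n = F (n + 1)}

/-- `k ∈ ℕ` is the complete reduction number of `F` with respect to `x`: `J F(n) = F(n + e)` for
all `n ≥ k e`, and no natural number `t < k` has this property. -/
def IsCompleteReductionNumber {d : ℕ} (F : (Fin s → ℤ) → Ideal R) (x : Fin s → Fin d → R)
    (k : ℕ) : Prop :=
  (∀ n : Fin s → ℤ, (∀ i, (k : ℤ) ≤ n i) → productIdeal x * F n = F (n + 1)) ∧
    ∀ t : ℕ, t < k →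
      ¬ ∀ n : Fin s → ℤ, (∀ i, (t : ℤ) ≤ n i) → productIdeal x * F n = F (n + 1)

/-- A Noetherian local ring is Cohen-Macaulay if it has a regular sequence whose length is the
Krull dimension. (Regular sequences in Mathlib generate a proper ideal, so they lie in the maximal
ideal.) -/
def IsCohenMacaulayLocal (R : Type u) [CommRing R] [IsNoetherianRing R] [IsLocalRing R] : Prop :=
  ∃ rs : List R, RingTheory.Sequence.IsRegular R rs ∧ (rs.length : WithBot ℕ∞) = ringKrullDim R

end MultiFil

namespace MultiFil

universe u

variable {R : Type u} [CommRing R] {s : ℕ}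

/-! In dimension one each complete reduction gives a principal ideal, say `(a)` and `(b)`, with `a`,
`b` regular. If `a F(n) = F(n + e)`, then `b F(n) ⊆ a F(n)`, so `b / a` maps `F(n)` into itself;
equality for large indices and Noetherianity make this map onto (`span_singleton_mul_le_of_mul_eq`).
Hence the set of `n` with `J F(n) = F(n + e)` does not depend on the reduction (`mul_eq_of_mul_eq`),
and neither does any number read off from it. -/

theorem productIdeal_eq_span_singleton (x : Fin s → Fin 1 → R) :
    productIdeal x = Ideal.span {∏ i, x i 0} := by
  rw [productIdeal, Set.range_unique]
  rfl

/-- If multiplication by `a` and by `b` have the same image on an ideal containing a regular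
element, then `b M ⊆ a M` forces `a M ⊆ b M`: in the total ring of fractions, the ascending chain
`(a / b) ^ i M` consists of submodules with a common denominator, hence is stationary. -/
theorem span_singleton_mul_le_of_mul_eq [IsNoetherianRing R] {a b c : R} {K M : Ideal R}
    (ha : a ∈ nonZeroDivisors R) (hc : c ∈ nonZeroDivisors R) (hcK : c ∈ K)
    (hK : Ideal.span {a} * K = Ideal.span {b} * K)
    (hM : Ideal.span {b} * M ≤ Ideal.span {a} * M) :
    Ideal.span {a} * M ≤ Ideal.span {b} * M := by
  -- That is, `(a / b) ^ i K ⊆ K`; this makes `c` a common denominator of all `(a / b) ^ i M`.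
  have hKpow : ∀ i : ℕ, ∀ k ∈ K, ∃ k' ∈ K, b ^ i * k' = a ^ i * k := by
    intro i
    induction i with
    | zero => exact fun k hk => ⟨k, hk, by simp⟩
    | succ i ih =>
      intro k hk
      obtain ⟨k', hk', h⟩ := ih k hk
      obtain ⟨l, hl, h'⟩ := Ideal.mem_span_singleton_mul.1
        (hK ▸ Ideal.mem_span_singleton_mul.2 ⟨k', hk', rfl⟩ : a * k' ∈ Ideal.span {b} * K)
      exact ⟨l, hl, by linear_combination b ^ i * h' + a * h⟩
  -- The `i`-th ideal stands for `c (a / b) ^ i M`, written without fractions.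
  let chain : ℕ →o Ideal R :=
    { toFun := fun i => Submodule.comap (LinearMap.mulLeft R (b ^ i)) (Ideal.span {a ^ i * c} * M)
      monotone' := monotone_nat_of_le_succ fun i r hr => by
        obtain ⟨m, hm, h⟩ := Ideal.mem_span_singleton_mul.1 (Submodule.mem_comap.1 hr)
        obtain ⟨m', hm', h'⟩ := Ideal.mem_span_singleton_mul.1
          (hM (Ideal.mem_span_singleton_mul.2 ⟨m, hm, rfl⟩))
        refine Submodule.mem_comap.2 (Ideal.mem_span_singleton_mul.2 ⟨m', hm', ?_⟩)
        simp only [LinearMap.mulLeft_apply] at h ⊢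
        linear_combination a ^ i * c * h' + b * h }
  obtain ⟨i, hi⟩ := monotone_stabilizes_iff_noetherian.2 ‹IsNoetherian R R› chain
  refine Ideal.span_singleton_mul_le_iff.2 fun m hm => ?_
  -- `w` plays the role of `c (a / b) ^ (i + 1) m`.
  obtain ⟨w, -, hw⟩ := hKpow (i + 1) (c * m) (Ideal.mul_mem_right m K hcK)
  have hmem : w ∈ chain (i + 1) := by
    refine Submodule.mem_comap.2 (Ideal.mem_span_singleton_mul.2 ⟨m, hm, ?_⟩)
    simp only [LinearMap.mulLeft_apply]
    linear_combination -hw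
  rw [← hi (i + 1) i.le_succ] at hmem
  obtain ⟨m', hm', h⟩ := Ideal.mem_span_singleton_mul.1 (Submodule.mem_comap.1 hmem)
  simp only [LinearMap.mulLeft_apply] at h
  refine Ideal.mem_span_singleton_mul.2 ⟨m', hm', ?_⟩
  refine (mul_cancel_left_mem_nonZeroDivisors (mul_mem (pow_mem ha i) hc)).1 ?_
  linear_combination b * h + hw

theorem exists_pow_mem_idealPow {I : Fin s → Ideal R} {z : R} (hz : ∀ i, z ∈ (I i).radical)
    (n : Fin s → ℤ) : ∃ j : ℕ, z ^ j ∈ idealPow I n := by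
  choose k hk using hz
  refine ⟨∑ i, k i * (n i).toNat, ?_⟩
  rw [← Finset.prod_pow_eq_pow_sum]
  refine Ideal.prod_mem_prod fun i _ => ?_
  rw [pow_mul]
  exact Ideal.pow_mem_pow (hk i) _

theorem IsCompleteReduction.exists_forall_mul_eq {d : ℕ} {I : Fin s → Ideal R}
    {F : (Fin s → ℤ) → Ideal R} {x : Fin s → Fin d → R} (hx : IsCompleteReduction I F x) :
    ∃ k : ℕ, ∀ n : Fin s → ℤ, (∀ i, (k : ℤ) ≤ n i) → productIdeal x * F n = F (n + 1) := by
  obtain ⟨-, N, hN⟩ := hx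
  refine ⟨Finset.univ.sup fun i => (N i).toNat, fun n hn => hN n fun i => ?_⟩
  have h : (N i).toNat ≤ Finset.univ.sup fun i => (N i).toNat :=
    Finset.le_sup (f := fun i => (N i).toNat) (Finset.mem_univ i)
  have := hn i
  change N i ≤ n i
  omega

/-- A power of `z` lies in `F(N + e) = J F(N)`, so the generator of `J` divides a regular element.
-/
theorem IsCompleteReduction.prod_mem_nonZeroDivisors {I : Fin s → Ideal R}
    {F : (Fin s → ℤ) → Ideal R} (hF : IsFiltration I F) {x : Fin s → Fin 1 → R}
    (hx : IsCompleteReduction I F x) {z : R} (hz : z ∈ nonZeroDivisors R)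
    (hzI : ∀ i, z ∈ (I i).radical) : ∏ i, x i 0 ∈ nonZeroDivisors R := by
  obtain ⟨-, N, hN⟩ := hx
  obtain ⟨j, hj⟩ := exists_pow_mem_idealPow hzI (N + 1)
  have h := hF.pow_le _ hj
  rw [← hN N le_rfl, productIdeal_eq_span_singleton] at h
  obtain ⟨r, -, hr⟩ := Ideal.mem_span_singleton_mul.1 h
  exact (mul_mem_nonZeroDivisors.1 (hr ▸ pow_mem hz j)).1

theorem span_prod_mul_le {I : Fin s → Ideal R} {F : (Fin s → ℤ) → Ideal R}
    (hF : IsFiltration I F) {x : Fin s → R} (hx : ∀ i, x i ∈ I i) (n : Fin s → ℤ) :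
    Ideal.span {∏ i, x i} * F n ≤ F (n + 1) := by
  have hle : F 1 * F n ≤ F (n + 1) := add_comm n 1 ▸ hF.mul_le n 1
  refine (Ideal.mul_mono_left ?_).trans hle
  refine (Ideal.span_singleton_le_iff_mem _).2 (hF.pow_le 1 ?_)
  refine Ideal.prod_mem_prod fun i _ => ?_
  simpa using hx i

/-- If `J F(n) = F(n + e)` holds for one complete reduction, then it holds, for the same `n`,
for every other complete reduction. -/
theorem IsCompleteReduction.mul_eq_of_mul_eq [IsNoetherianRing R] {I : Fin s → Ideal R}
    {F : (Fin s → ℤ) → Ideal R} (hF : IsFiltration I F) {z : R} (hz : z ∈ nonZeroDivisors R)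
    (hzI : ∀ i, z ∈ (I i).radical) {x y : Fin s → Fin 1 → R} (hx : IsCompleteReduction I F x)
    (hy : IsCompleteReduction I F y) {n : Fin s → ℤ} (h : productIdeal x * F n = F (n + 1)) :
    productIdeal y * F n = F (n + 1) := by
  have ha := hx.prod_mem_nonZeroDivisors hF hz hzI
  obtain ⟨-, N, hN⟩ := hx
  obtain ⟨hyI, N', hN'⟩ := hy
  -- At `N ⊔ N'` both reductions work, so `F (N ⊔ N')` serves as `K` and `z ^ j` as `c`.
  obtain ⟨j, hj⟩ := exists_pow_mem_idealPow hzI (N ⊔ N')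
  have hK := (hN _ le_sup_left).trans (hN' (N ⊔ N') le_sup_right).symm
  have hy_le := span_prod_mul_le hF (fun i => hyI i 0) n
  rw [productIdeal_eq_span_singleton] at h ⊢
  rw [productIdeal_eq_span_singleton, productIdeal_eq_span_singleton] at hK
  refine hy_le.antisymm ?_
  rw [← h] at hy_le ⊢
  exact span_singleton_mul_le_of_mul_eq ha (pow_mem hz j) (hF.pow_le _ hj) hK hy_le

/-- Reduction vectors are closed upwards, so `r` may be replaced by the constant vector with entry
`max r`. -/
theorem IsCompleteReductionNumber.isLeast {d : ℕ} {F : (Fin s → ℤ) → Ideal R}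
    {x : Fin s → Fin d → R} {k : ℕ} (hk : IsCompleteReductionNumber F x k) :
    IsLeast ((fun r : Fin s → ℕ => Finset.univ.sup r) '' reductionVectors F x) k := by
  have lower : k ∈ lowerBounds
      ((fun r : Fin s → ℕ => Finset.univ.sup r) '' reductionVectors F x) := by
    rintro _ ⟨r, hr, rfl⟩
    by_contra! hlt
    refine hk.2 _ hlt fun n hn => hr n fun i => le_trans ?_ (hn i)
    exact_mod_cast Finset.le_sup (f := r) (Finset.mem_univ i)
  have hmem : (fun _ => k) ∈ reductionVectors F x := hk.1
  refine ⟨⟨_, hmem, le_antisymm (Finset.sup_le fun _ _ => le_rfl) ?_⟩, lower⟩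
  exact lower ⟨_, hmem, rfl⟩

theorem exists_mem_nonZeroDivisors_of_isCohenMacaulayLocal [IsNoetherianRing R] [IsLocalRing R]
    (hCM : IsCohenMacaulayLocal R) (hdim : ringKrullDim R = 1) :
    ∃ z ∈ IsLocalRing.maximalIdeal R, z ∈ nonZeroDivisors R := by
  obtain ⟨rs, hreg, hlen⟩ := hCM
  rw [hdim] at hlen
  have hlen' : rs.length = 1 := by exact_mod_cast hlen
  obtain ⟨z, rfl⟩ := List.length_eq_one_iff.1 hlen'
  refine ⟨z, IsLocalRing.le_maximalIdeal ?_ (Ideal.subset_span (by simp) : z ∈ Ideal.ofList [z]),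
    ?_⟩
  · intro htop
    exact hreg.top_ne_smul (by rw [Ideal.ofList, htop, Submodule.top_smul])
  · have := ((RingTheory.Sequence.isWeaklyRegular_cons_iff R z []).1 hreg.toIsWeaklyRegular).1
    exact mem_nonZeroDivisors_iff_right.2 fun w hw =>
      this.right_eq_zero_of_smul (by rwa [smul_eq_mul, mul_comm])

end MultiFil

/-- The ideals `I i` are primary to the maximal ideal (equivalently, their radical is the maximal
ideal). In dimension one a complete reduction consists of one element of each `I i`. -/
theorem theorem5p4 {R : Type*} [CommRing R] [IsNoetherianRing R] [IsLocalRing R]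
    (hCM : MultiFil.IsCohenMacaulayLocal R) (hdim : ringKrullDim R = 1)
    (s : ℕ) (hs : 1 ≤ s) (I : Fin s → Ideal R)
    (hI : ∀ i, (I i).radical = IsLocalRing.maximalIdeal R)
    (F : (Fin s → ℤ) → Ideal R) (hF : MultiFil.IsAdmissible I F) :
    ∃ k : ℕ, ∀ x : Fin s → Fin 1 → R, MultiFil.IsCompleteReduction I F x →
      MultiFil.IsCompleteReductionNumber F x k ∧
      IsLeast ((fun r : Fin s → ℕ => Finset.univ.sup r) '' MultiFil.reductionVectors F x) k := by
  classical
  obtain ⟨z, hzm, hz⟩ := MultiFil.exists_mem_nonZeroDivisors_of_isCohenMacaulayLocal hCM hdim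
  have hzI : ∀ i, z ∈ (I i).radical := fun i => (hI i).symm ▸ hzm
  by_cases hex : ∃ x : Fin s → Fin 1 → R, MultiFil.IsCompleteReduction I F x
  · obtain ⟨x, hx⟩ := hex
    have hk := hx.exists_forall_mul_eq
    refine ⟨Nat.find hk, fun y hy => ?_⟩
    have hnum : MultiFil.IsCompleteReductionNumber F y (Nat.find hk) :=
      ⟨fun n hn => hx.mul_eq_of_mul_eq hF.toIsFiltration hz hzI hy (Nat.find_spec hk n hn),
        fun t ht h => Nat.find_min hk ht fun n hn =>
          hy.mul_eq_of_mul_eq hF.toIsFiltration hz hzI hx (h n hn)⟩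
    exact ⟨hnum, hnum.isLeast⟩
  -- Without complete reductions the claim is vacuous and `0` is an arbitrary choice.
  · exact ⟨0, fun x hx => absurd ⟨x, hx⟩ hex⟩
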